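/- Let $(F,g_F)$ be a compact connected smooth Riemannian manifold without boundary and let $f\colon F\to(0,\infty)$ be a $C^\infty$ function. Denote by $\mathrm{grad}_F\psi$ the gradient of a function $\psi$ and by $\mathrm H_F^\psi(X,Y)=g_F(\nabla_X\,\mathrm{grad}_F\psi,Y)$ its Hessian, where $\nabla$ is the Levi-Civita connection of $g_F$; for a vector field $Z$ and a smooth function $\varphi$ put $B_Z^\varphi=\mathrm d\varphi\otimes g_F(Z,\cdot)+g_F(\cdot,Z)\otimes\mathrm d\varphi$. For $\nu\in\mathbb R$ and $\psi\colon F\to\mathbb R$ consider the system $$ \psi\in C^\infty(F),\qquad \mathrm H_F^\psi+\frac1f\,B_{\mathrm{grad}_F\psi}^{f}=0,\qquad f\,g_F(\mathrm{grad}_F\psi,\mathrm{grad}_F f)=\nu\psi . \tag{$*$} $$ If $\psi$ is not identically zero, then $(\nu,\psi)$ satisfies $(*)$ if and only if $\nu=0$ and $\psi$ is constant. (The pair $(\nu,0)$ satisfies $(*)$ for every $\nu\in\mathbb R$.) -/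

import Mathlib

open Bundle Manifold
open scoped ContDiff InnerProductSpace

namespace RiemannianHessian

variable {E : Type*} [NormedAddCommGroup E] [NormedSpace ℝ E]
  {H : Type*} [TopologicalSpace H] {I : ModelWithCorners ℝ E H}
  {M : Type*} [TopologicalSpace M] [ChartedSpace H M]
  [RiemannianBundle (fun x : M => TangentSpace I x)]

variable (I) in
/-- The tensor `B_Z^φ = dφ ⊗ ⟪Z, ·⟫ + ⟪·, Z⟫ ⊗ dφ` at the point `x`. -/
noncomputable def tensorB (Z : Π x : M, TangentSpace I x) (φ : M → ℝ) (x : M)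
    (v w : TangentSpace I x) : ℝ :=
  mvfderiv I φ x v * inner ℝ (Z x) w + inner ℝ v (Z x) * mvfderiv I φ x w

variable [FiniteDimensional ℝ E]

/-- The vector dual to a continuous linear functional on the tangent space `T_x M`, with respect
to the Riemannian metric: `⟪sharp x φ, w⟫ = φ w`. -/
noncomputable def sharp (x : M) :
    (TangentSpace I x →L[ℝ] ℝ) →ₗ[ℝ] TangentSpace I x :=
  haveI : FiniteDimensional ℝ (TangentSpace I x) := inferInstanceAs (FiniteDimensional ℝ E)
  haveI : CompleteSpace (TangentSpace I x) := FiniteDimensional.complete ℝ _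
  { toFun := fun φ => (InnerProductSpace.toDual ℝ (TangentSpace I x)).symm φ
    map_add' := fun φ φ' => map_add _ φ φ'
    map_smul' := fun c φ => by simp }

theorem inner_sharp (x : M) (φ : TangentSpace I x →L[ℝ] ℝ) (w : TangentSpace I x) :
    inner ℝ (sharp x φ) w = φ w := by
  have : FiniteDimensional ℝ (TangentSpace I x) := inferInstanceAs (FiniteDimensional ℝ E)
  have : CompleteSpace (TangentSpace I x) := FiniteDimensional.complete ℝ _
  exact InnerProductSpace.toDual_symm_apply

variable (I) in
/-- The gradient of a function on a Riemannian manifold: `⟪grad ψ, w⟫ = dψ(w)`. -/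
noncomputable def grad (ψ : M → ℝ) (x : M) : TangentSpace I x :=
  sharp x (mvfderiv I ψ x)

variable (I) in
/-- The right-hand side `K(X, Y, Z)` of the Koszul formula `2 ⟪∇_X Y, Z⟫ = K(X, Y, Z)`. -/
noncomputable def koszul (X Y Z : Π x : M, TangentSpace I x) (x : M) : ℝ :=
  mvfderiv I (fun p => (inner ℝ (Y p) (Z p) : ℝ)) x (X x)
    + mvfderiv I (fun p => (inner ℝ (X p) (Z p) : ℝ)) x (Y x)
    - mvfderiv I (fun p => (inner ℝ (X p) (Y p) : ℝ)) x (Z x)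
    + inner ℝ (VectorField.mlieBracket I X Y x) (Z x)
    - inner ℝ (VectorField.mlieBracket I X Z x) (Y x)
    - inner ℝ (VectorField.mlieBracket I Y Z x) (X x)

variable [IsManifold I ∞ M]
  [IsContMDiffRiemannianBundle I ∞ E (fun x : M => TangentSpace I x)]

theorem mdiffAt_inner {X Y : Π x : M, TangentSpace I x} {x : M}
    (hX : MDiffAt (T% X) x) (hY : MDiffAt (T% Y) x) :
    MDiffAt (fun p => (inner ℝ (X p) (Y p) : ℝ)) x :=
  MDifferentiableAt.inner_bundle (IB := I) (F := E) (E := fun x : M => TangentSpace I x)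
    (b := fun p => p) hX hY

theorem koszul_tensorial_right {X Y : Π x : M, TangentSpace I x} {x : M}
    (hX : MDiffAt (T% X) x) (hY : MDiffAt (T% Y) x) :
    TensorialAt I E (fun Z => koszul I X Y Z x) x where
  smul {f Z} hf hZ := by
    have : CompleteSpace E := FiniteDimensional.complete ℝ E
    simp [koszul, mvfderiv_fun_mul hf (mdiffAt_inner hX hZ),
      mvfderiv_fun_mul hf (mdiffAt_inner hY hZ), VectorField.mlieBracket_smul_right hf hZ,
      inner_add_left, inner_smul_left, inner_smul_right, real_inner_comm]
    ring
  add {Z Z'} hZ hZ' := by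
    have : CompleteSpace E := FiniteDimensional.complete ℝ E
    simp [koszul, mvfderiv_fun_add (mdiffAt_inner hX hZ) (mdiffAt_inner hX hZ'),
      mvfderiv_fun_add (mdiffAt_inner hY hZ) (mdiffAt_inner hY hZ'),
      VectorField.mlieBracket_add_right hZ hZ', inner_add_left, inner_add_right]
    ring

theorem koszul_tensorial_left {Y Z : Π x : M, TangentSpace I x} {x : M}
    (hY : MDiffAt (T% Y) x) (hZ : MDiffAt (T% Z) x) :
    TensorialAt I E (fun X => koszul I X Y Z x) x where
  smul {f X} hf hX := by
    have : CompleteSpace E := FiniteDimensional.complete ℝ E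
    simp [koszul, mvfderiv_fun_mul hf (mdiffAt_inner hX hZ),
      mvfderiv_fun_mul hf (mdiffAt_inner hX hY), VectorField.mlieBracket_smul_left hf hX,
      inner_add_left, inner_smul_left, inner_smul_right]
    ring
  add {X X'} hX hX' := by
    have : CompleteSpace E := FiniteDimensional.complete ℝ E
    simp [koszul, mvfderiv_fun_add (mdiffAt_inner hX hZ) (mdiffAt_inner hX' hZ),
      mvfderiv_fun_add (mdiffAt_inner hX hY) (mdiffAt_inner hX' hY),
      VectorField.mlieBracket_add_left hX hX', inner_add_left, inner_add_right]
    ring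

open Classical in
/-- The underlying function of the Levi-Civita connection: `leviCivitaAux Y x v` is the tangent
vector `(∇_v Y)(x)` determined by the Koszul formula (and `0` if `Y` is not differentiable
at `x`). -/
noncomputable def leviCivitaAux (Y : Π x : M, TangentSpace I x) (x : M) :
    TangentSpace I x →L[ℝ] TangentSpace I x :=
  if hY : MDiffAt (T% Y) x then
    haveI : FiniteDimensional ℝ (TangentSpace I x) := inferInstanceAs (FiniteDimensional ℝ E)
    LinearMap.toContinuousLinearMap ((1 / 2 : ℝ) • (sharp x).comp
      (TensorialAt.mkHom₂ (F := E) (F' := E) (fun X Z => koszul I X Y Z x) x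
        (fun _ hZ => koszul_tensorial_left hY hZ)
        (fun _ hX => koszul_tensorial_right hX hY)).toLinearMap)
  else 0

theorem inner_leviCivitaAux {X Y Z : Π x : M, TangentSpace I x} {x : M}
    (hX : MDiffAt (T% X) x) (hY : MDiffAt (T% Y) x) (hZ : MDiffAt (T% Z) x) :
    inner ℝ (leviCivitaAux Y x (X x)) (Z x) = (1 / 2 : ℝ) * koszul I X Y Z x := by
  have h := TensorialAt.mkHom₂_apply (F := E) (F' := E) (Φ := fun X Z => koszul I X Y Z x)
    (fun _ hZ => koszul_tensorial_left hY hZ) (fun _ hX => koszul_tensorial_right hX hY) hX hZ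
  rw [leviCivitaAux, dif_pos hY, ← h, ← inner_sharp]
  exact real_inner_smul_left _ _ _

/-- Two endomorphisms of `T_x M` agree if all their matrix entries on values at `x` of vector
fields differentiable at `x` agree. -/
theorem endo_ext {x : M} {A B : TangentSpace I x →L[ℝ] TangentSpace I x}
    (h : ∀ X Z : Π x : M, TangentSpace I x, MDiffAt (T% X) x → MDiffAt (T% Z) x →
      (inner ℝ (A (X x)) (Z x) : ℝ) = inner ℝ (B (X x)) (Z x)) : A = B := by
  ext v
  refine ext_inner_right ℝ fun w => ?_
  simpa using h (FiberBundle.extend E v) (FiberBundle.extend E w)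
    (FiberBundle.mdifferentiableAt_extend ..) (FiberBundle.mdifferentiableAt_extend ..)

variable (I M) in
/-- The Levi-Civita connection of a smooth Riemannian manifold; `leviCivita I M Y x v` is
`(∇_v Y)(x)`. -/
noncomputable def leviCivita : CovariantDerivative I E (fun x : M => TangentSpace I x) where
  toFun := leviCivitaAux
  isCovariantDerivativeOnUniv :=
    { add := by
        intro Y Y' x hY hY' _
        have : CompleteSpace E := FiniteDimensional.complete ℝ E
        refine endo_ext fun X Z hX hZ => ?_
        rw [inner_leviCivitaAux hX (mdifferentiableAt_add_section hY hY') hZ, add_apply,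
          inner_add_left, inner_leviCivitaAux hX hY hZ, inner_leviCivitaAux hX hY' hZ]
        simp [koszul, mvfderiv_fun_add (mdiffAt_inner hY hZ) (mdiffAt_inner hY' hZ),
          mvfderiv_fun_add (mdiffAt_inner hX hY) (mdiffAt_inner hX hY'),
          VectorField.mlieBracket_add_right hY hY', VectorField.mlieBracket_add_left hY hY',
          inner_add_left, inner_add_right]
        ring
      leibniz := by
        intro Y f x hY hf _
        have : CompleteSpace E := FiniteDimensional.complete ℝ E
        refine endo_ext fun X Z hX hZ => ?_
        rw [inner_leviCivitaAux hX (hf.smul_section hY) hZ, add_apply,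
          inner_add_left, smul_apply, real_inner_smul_left,
          inner_leviCivitaAux hX hY hZ]
        simp [koszul, mvfderiv_fun_mul hf (mdiffAt_inner hY hZ),
          mvfderiv_fun_mul hf (mdiffAt_inner hY hX),
          VectorField.mlieBracket_smul_right hf hY, VectorField.mlieBracket_smul_left hf hY,
          inner_add_left, inner_smul_left, inner_smul_right, real_inner_comm]
        ring }

/-- The Levi-Civita connection is torsion-free. -/
theorem leviCivita_torsionFree {X Y : Π x : M, TangentSpace I x} {x : M}
    (hX : MDiffAt (T% X) x) (hY : MDiffAt (T% Y) x) :
    leviCivita I M Y x (X x) - leviCivita I M X x (Y x) = VectorField.mlieBracket I X Y x := by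
  refine ext_inner_right ℝ fun w => ?_
  have hZ := FiberBundle.mdifferentiableAt_extend (I := I) (F := E) w
  have h1 := inner_leviCivitaAux hX hY hZ
  have h2 := inner_leviCivitaAux hY hX hZ
  rw [FiberBundle.extend_apply_self] at h1 h2
  rw [inner_sub_left]
  refine (congrArg₂ (· - ·) h1 h2).trans ?_
  simp [koszul, VectorField.mlieBracket_swap_apply (V := Y) (W := X), real_inner_comm]
  ring

/-- The Levi-Civita connection is compatible with the metric. -/
theorem leviCivita_metric {X Y Z : Π x : M, TangentSpace I x} {x : M}
    (hX : MDiffAt (T% X) x) (hY : MDiffAt (T% Y) x) (hZ : MDiffAt (T% Z) x) :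
    mvfderiv I (fun p => (inner ℝ (Y p) (Z p) : ℝ)) x (X x) =
      inner ℝ (leviCivita I M Y x (X x)) (Z x) + inner ℝ (Y x) (leviCivita I M Z x (X x)) := by
  have h1 := inner_leviCivitaAux hX hY hZ
  have h2 := inner_leviCivitaAux hX hZ hY
  rw [real_inner_comm _ (Y x)]
  refine Eq.trans ?_ (congrArg₂ (· + ·) h1 h2).symm
  simp [koszul, VectorField.mlieBracket_swap_apply (V := Z) (W := Y), real_inner_comm]
  ring

variable (I) in
/-- The Hessian tensor `H^ψ(v, w) = ⟪∇_v grad ψ, w⟫` at the point `x`. -/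
noncomputable def hessian (ψ : M → ℝ) (x : M) (v w : TangentSpace I x) : ℝ :=
  inner ℝ (leviCivita I M (grad I ψ) x v) w

variable (I) in
/-- The pair `(ν, ψ)` satisfies the system with warping function `f`: `f` is smooth and positive,
`ψ` is smooth, `H^ψ + (1/f) B_{grad ψ}^f = 0` and `f ⟪grad ψ, grad f⟫ = ν ψ`. -/
structure SatisfiesSystem (f : M → ℝ) (ν : ℝ) (ψ : M → ℝ) : Prop where
  smooth_f : ContMDiff I 𝓘(ℝ, ℝ) ∞ f
  pos_f : ∀ x, 0 < f x
  smooth_ψ : ContMDiff I 𝓘(ℝ, ℝ) ∞ ψ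
  hessian_eq : ∀ (x : M) (v w : TangentSpace I x),
    hessian I ψ x v w + 1 / f x * tensorB I (grad I ψ) f x v w = 0
  gradient_eq : ∀ x : M, f x * inner ℝ (grad I ψ x) (grad I f x) = ν * ψ x

end RiemannianHessian

open scoped Topology

/-! Put `u = |grad ψ|²`. Metric compatibility and the Hessian equation give `du(v) = 2 H^ψ(v, grad
ψ) = -(2/f) B(v, grad ψ)`, and Cauchy–Schwarz bounds this by `4 (|grad f| / f) |v| u`. By
compactness the coefficient has a maximum `K`, so `|du(v)| ≤ K |v| u`. A Grönwall argument makes the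
zero set of such a `u` open; it is also closed, and it contains a maximum point of `ψ`. By
connectedness `u = 0`, hence `ψ` is constant. The gradient equation then reads `0 = ν ψ`, which
forces `ν = 0` when `ψ ≠ 0`. -/

namespace RiemannianHessian

/-! ### Differentiability of the gradient field -/

section Gradient

variable {E : Type*} [NormedAddCommGroup E] [NormedSpace ℝ E] [FiniteDimensional ℝ E]
  {H : Type*} [TopologicalSpace H] {I : ModelWithCorners ℝ E H}
  {M : Type*} [TopologicalSpace M] [ChartedSpace H M]
  [RiemannianBundle (fun x : M => TangentSpace I x)]

theorem inner_grad (ψ : M → ℝ) (x : M) (w : TangentSpace I x) :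
    inner ℝ (grad I ψ x) w = mvfderiv I ψ x w :=
  inner_sharp x _ w

variable [IsManifold I ∞ M]
  [IsContMDiffRiemannianBundle I ∞ E (fun x : M => TangentSpace I x)]

/-- In a trivialization around `x` the metric becomes a family `G` of bilinear forms and `dψ` a
family `D` of covectors, both differentiable at `x`. The gradient has coordinates `G⁻¹ D`, and
inversion is differentiable at an invertible operator. -/
theorem mdiffAt_grad {ψ : M → ℝ} (hψ : ContMDiff I 𝓘(ℝ, ℝ) ∞ ψ) (x : M) :
    MDiffAt (T% (grad I ψ)) x := by
  obtain ⟨g, hg, hgi⟩ := IsContMDiffRiemannianBundle.exists_contMDiff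
    (IB := I) (n := ∞) (F := E) (E := fun x : M => TangentSpace I x)
  set e := trivializationAt E (TangentSpace I : M → Type _) x with he
  have hx : x ∈ e.baseSet := FiberBundle.mem_baseSet_trivializationAt' x
  have : CompleteSpace E := FiniteDimensional.complete ℝ E
  let G : M → E →L[ℝ] E →L[ℝ] ℝ := fun y =>
    ContinuousLinearMap.inCoordinates E (fun x : M => TangentSpace I x) (E →L[ℝ] ℝ)
      (fun x : M => TangentSpace I x →L[ℝ] ℝ) x y x y (g y)
  have hG : MDiffAt G x :=
    ((contMDiffAt_hom_bundle _).1 (hg x)).2.mdifferentiableAt (by simp)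
  have hGi : ∀ y ∈ e.baseSet, ∀ v w : E, G y v w = inner ℝ (e.symm y v) (e.symm y w) := by
    intro y hy v w
    rw [hgi]
    refine (inCoordinates_apply_eq₂ hy hy (Set.mem_univ _)).trans ?_
    simp [he]
  let D : M → E →L[ℝ] ℝ := inTangentCoordinates I 𝓘(ℝ, ℝ) id ψ (mfderiv% ψ) x
  have hD : MDiffAt D x :=
    ((hψ x).mfderiv_const (m := 1) (by norm_cast)).mdifferentiableAt one_ne_zero
  have hDi : ∀ y ∈ e.baseSet, ∀ v : E, D y v = mvfderiv I ψ y (e.symm y v) := by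
    intro y hy v
    have := ContinuousLinearMap.inCoordinates_eq (F := E) (E := (TangentSpace I : M → Type _))
      (F' := ℝ) (E' := (TangentSpace 𝓘(ℝ, ℝ) : ℝ → Type _)) (x₀ := x) (y₀ := ψ x)
      (ϕ := mfderiv% ψ y) hy (by simp [chartAt_self_eq])
    refine (DFunLike.congr_fun this v).trans ?_
    have h1 := DFunLike.congr_fun (TangentBundle.continuousLinearMapAt_model_space (𝕜 := ℝ)
      (ψ x) (ψ y)) (mfderiv% ψ y (e.symm y v))
    rw [Bundle.Trivialization.continuousLinearMapAt_apply,
      Bundle.Trivialization.coe_linearMapAt_of_mem _ (by simp [chartAt_self_eq])] at h1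
    exact h1
  -- Positive definiteness makes `G y` injective, and `E` and its dual have equal dimension.
  have hinv : ∀ y ∈ e.baseSet, (G y).IsInvertible := by
    intro y hy
    have hinj : Function.Injective (G y) := by
      refine (injective_iff_map_eq_zero (G y)).2 fun v hv => ?_
      have h := hGi y hy v v
      rw [hv] at h
      have h0 : e.symm y v = 0 := inner_self_eq_zero.1 h.symm
      have := e.apply_mk_symm hy v
      rw [h0] at this
      have h1 := congrArg Prod.snd (e.zeroSection ℝ hy)
      rw [zeroSection, this] at h1
      exact h1
    have hdim : Module.finrank ℝ E = Module.finrank ℝ (E →L[ℝ] ℝ) := by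
      rw [← (LinearMap.toContinuousLinearMap (𝕜 := ℝ) (E := E) (F' := ℝ)).finrank_eq]
      exact (Subspace.dual_finrank_eq).symm
    exact ⟨(LinearEquiv.ofInjectiveOfFinrankEq (G y).toLinearMap hinj hdim).toContinuousLinearEquiv,
      by ext; rfl⟩
  have hc : MDiffAt (fun y => (G y).inverse (D y)) x := by
    have h1 : MDiffAt (fun y => (G y).inverse) x :=
      (((hinv x hx).contDiffAt_map_inverse (n := 1)).differentiableAt
        one_ne_zero).mdifferentiableAt.comp x hG
    exact h1.clm_apply hD
  refine (mdifferentiableAt_section I _).2 (hc.congr_of_eventuallyEq ?_)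
  filter_upwards [e.open_baseSet.mem_nhds hx] with y hy
  set v := (e (TotalSpace.mk y (grad I ψ y))).2 with hv
  have hsv : e.symm y v = grad I ψ y := e.symm_apply_apply_mk hy _
  have hGD : G y v = D y := by
    ext w
    rw [hGi y hy, hDi y hy, hsv, inner_grad]
  change v = (G y).inverse (D y)
  obtain ⟨A, hA⟩ := hinv y hy
  rw [← hGD, ← hA]
  simp

end Gradient
end RiemannianHessian

namespace RiemannianHessian
-- Unique continuation from a Grönwall inequality
section UniqueContinuation

variable {E : Type*} [NormedAddCommGroup E] [NormedSpace ℝ E]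
  {H : Type*} [TopologicalSpace H] {I : ModelWithCorners ℝ E H} [I.Boundaryless]
  {M : Type*} [TopologicalSpace M] [ChartedSpace H M]
  [RiemannianBundle (fun x : M => TangentSpace I x)] [IsManifold I 1 M]
  [IsContinuousRiemannianBundle E (fun x : M => TangentSpace I x)]

-- Tangent spaces of the model space `E` get the norm of `E`, so that the derivative of a chart
-- inverse has an operator norm.
attribute [local instance] normedAddCommGroupTangentSpaceVectorSpace
  normedSpaceTangentSpaceVectorSpace

/-- A function whose differential is bounded by a multiple of its absolute value vanishes near
each of its zeros. -/
theorem eventually_eq_zero_of_abs_mvfderiv_le {h : M → ℝ} (hh : MDifferentiable I 𝓘(ℝ, ℝ) h)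
    {K : ℝ} (hK0 : 0 ≤ K)
    (hK : ∀ (x : M) (v : TangentSpace I x), |mvfderiv I h x v| ≤ K * ‖v‖ * |h x|)
    {x : M} (hx : h x = 0) : ∀ᶠ y in 𝓝 x, h y = 0 := by
  -- `C` compares the Riemannian norm with the norm of `E` near `x`, turning the hypothesis into an
  -- estimate in the chart.
  obtain ⟨C, hC0, hC⟩ := eventually_norm_mfderivWithin_symm_extChartAt_lt I x
  set φ := extChartAt I x with hφ
  rw [I.range_eq_univ, nhdsWithin_univ] at hC
  obtain ⟨r, hr0, hr⟩ := Metric.eventually_nhds_iff_ball.1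
    (hC.and (extChartAt_target_mem_nhds (I := I) x))
  have hd : ∀ z ∈ Metric.ball (φ x) r, ∃ L : E →L[ℝ] ℝ, HasFDerivAt (h ∘ φ.symm) L z ∧
      ∀ w : E, |L w| ≤ K * C * ‖w‖ * |h (φ.symm z)| := by
    intro z hz
    obtain ⟨h1, h2⟩ := hr z hz
    have hs : MDifferentiableAt 𝓘(ℝ, E) I φ.symm z := by
      have := mdifferentiableWithinAt_extChartAt_symm (I := I) h2
      rwa [I.range_eq_univ, mdifferentiableWithinAt_univ] at this
    rw [mfderivWithin_univ] at h1
    have hcomp := (hh (φ.symm z)).hasMFDerivAt.comp z hs.hasMFDerivAt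
    refine ⟨_, hasMFDerivAt_iff_hasFDerivAt.1 hcomp, fun w => ?_⟩
    refine (hK (φ.symm z) (mfderiv 𝓘(ℝ, E) I φ.symm z w)).trans ?_
    have : ‖mfderiv 𝓘(ℝ, E) I φ.symm z w‖ ≤ C * ‖w‖ :=
      ContinuousLinearMap.le_of_opNorm_le _ h1.le w
    rw [mul_assoc K C]
    gcongr
  have hball : ∀ z ∈ Metric.ball (φ x) r, h (φ.symm z) = 0 := by
    intro z hz
    let c : ℝ → E := AffineMap.lineMap (φ x) z
    have hcd : ∀ t, HasDerivAt c (z - φ x) t := fun t => AffineMap.hasDerivAt_lineMap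
    have hcb : ∀ t ∈ Set.Icc (0 : ℝ) 1, c t ∈ Metric.ball (φ x) r := fun t ht =>
      (convex_ball _ _).lineMap_mem (Metric.mem_ball_self hr0) hz ht
    choose! L hL hLb using hd
    have hder : ∀ t ∈ Set.Icc (0 : ℝ) 1,
        HasDerivAt (fun t => h (φ.symm (c t))) (L (c t) (z - φ x)) t := fun t ht =>
      (hL _ (hcb t ht)).comp_hasDerivAt t (hcd t)
    -- Grönwall along the segment from the chart image of `x`, where `h` vanishes, to `z`.
    have := eq_zero_of_abs_deriv_le_mul_abs_self_of_eq_zero_right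
      (f := fun t => h (φ.symm (c t))) (K := K * C * ‖z - φ x‖) (a := 0) (b := 1)
      (fun t ht => (hder t ht).continuousAt.continuousWithinAt)
      (fun t ht => (hder t (Set.Ico_subset_Icc_self ht)).hasDerivWithinAt)
      (by simpa [c, hφ] using hx)
      (fun t ht => hLb _ (hcb t (Set.Ico_subset_Icc_self ht)) _) 1 (by simp)
    simpa [c] using this
  filter_upwards [(continuousAt_extChartAt (I := I) x).preimage_mem_nhds
    (Metric.ball_mem_nhds _ hr0), extChartAt_source_mem_nhds (I := I) x] with y hy hy'
  have := hball _ hy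
  rwa [φ.left_inv hy'] at this

/-- On a connected manifold, a function whose differential is bounded by a multiple of its
absolute value vanishes identically as soon as it vanishes at one point. -/
theorem eq_zero_of_abs_mvfderiv_le [PreconnectedSpace M] {h : M → ℝ}
    (hh : MDifferentiable I 𝓘(ℝ, ℝ) h) {K : ℝ} (hK0 : 0 ≤ K)
    (hK : ∀ (x : M) (v : TangentSpace I x), |mvfderiv I h x v| ≤ K * ‖v‖ * |h x|)
    {x₀ : M} (hx₀ : h x₀ = 0) (x : M) : h x = 0 := by
  have hclopen : IsClopen {x | h x = 0} :=
    ⟨isClosed_eq hh.continuous continuous_const,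
      isOpen_iff_mem_nhds.2 fun _ hy => eventually_eq_zero_of_abs_mvfderiv_le hh hK0 hK hy⟩
  exact (hclopen.eq_univ ⟨x₀, hx₀⟩).ge (Set.mem_univ x)

end UniqueContinuation
end RiemannianHessian

namespace RiemannianHessian
-- Vanishing of the differential at a maximum
section Extremum

variable {E : Type*} [NormedAddCommGroup E] [NormedSpace ℝ E]
  {H : Type*} [TopologicalSpace H] {I : ModelWithCorners ℝ E H} [I.Boundaryless]
  {M : Type*} [TopologicalSpace M] [ChartedSpace H M]

theorem mvfderiv_eq_zero_of_isMax {ψ : M → ℝ} {x : M} (hψ : MDiffAt ψ x)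
    (hx : ∀ y, ψ y ≤ ψ x) : mvfderiv I ψ x = 0 := by
  -- The maximum is global, so the bound holds whatever values the chart inverse takes off its
  -- target.
  have hmax : IsLocalMax (ψ ∘ (extChartAt I x).symm) (extChartAt I x x) :=
    Filter.Eventually.of_forall fun z => by simpa using hx _
  have h0 : mfderiv I 𝓘(ℝ, ℝ) ψ x = 0 := by
    rw [hψ.mfderiv, I.range_eq_univ, fderivWithin_univ]
    exact hmax.fderiv_eq_zero
  rw [mvfderiv, h0]
  exact ContinuousLinearMap.comp_zero _

end Extremum

/-! ### The Hessian equation forces constancy -/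

section Hessian

variable {E : Type*} [NormedAddCommGroup E] [NormedSpace ℝ E] [FiniteDimensional ℝ E]
  {H : Type*} [TopologicalSpace H] {I : ModelWithCorners ℝ E H}
  {M : Type*} [TopologicalSpace M] [ChartedSpace H M]
  [RiemannianBundle (fun x : M => TangentSpace I x)]

theorem grad_const (c : ℝ) : grad I (fun _ : M => c) = 0 := by
  funext x
  simp [grad, mvfderiv_const]

theorem abs_mvfderiv_le (ψ : M → ℝ) (x : M) (v : TangentSpace I x) :
    |mvfderiv I ψ x v| ≤ ‖grad I ψ x‖ * ‖v‖ := by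
  rw [← inner_grad]
  exact abs_real_inner_le_norm _ _

/-- Inserting `grad I ψ x` in the second slot makes the bound proportional to `‖grad I ψ x‖ ^ 2`,
the very quantity being differentiated in the Grönwall argument. -/
theorem abs_tensorB_le (f ψ : M → ℝ) (x : M) (v : TangentSpace I x) :
    |tensorB I (grad I ψ) f x v (grad I ψ x)| ≤
      2 * (‖grad I f x‖ * ‖v‖ * ‖grad I ψ x‖ ^ 2) := by
  have h1 := abs_mvfderiv_le f x v
  have h2 := abs_mvfderiv_le f x (grad I ψ x)
  have h3 := abs_real_inner_le_norm v (grad I ψ x)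
  rw [tensorB, real_inner_self_eq_norm_sq]
  refine (abs_add_le _ _).trans ?_
  rw [abs_mul, abs_mul, abs_of_nonneg (sq_nonneg ‖grad I ψ x‖)]
  calc _ ≤ ‖grad I f x‖ * ‖v‖ * ‖grad I ψ x‖ ^ 2
        + ‖v‖ * ‖grad I ψ x‖ * (‖grad I f x‖ * ‖grad I ψ x‖) := by gcongr
    _ = _ := by ring

variable [IsManifold I ∞ M]
  [IsContMDiffRiemannianBundle I ∞ E (fun x : M => TangentSpace I x)]

theorem hessian_const (c : ℝ) (x : M) (v w : TangentSpace I x) :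
    hessian I (fun _ : M => c) x v w = 0 := by
  rw [hessian, grad_const, CovariantDerivative.zero]
  simp

theorem mdifferentiable_inner_grad {ψ φ : M → ℝ} (hψ : ContMDiff I 𝓘(ℝ, ℝ) ∞ ψ)
    (hφ : ContMDiff I 𝓘(ℝ, ℝ) ∞ φ) :
    MDifferentiable I 𝓘(ℝ, ℝ) fun x => (inner ℝ (grad I ψ x) (grad I φ x) : ℝ) :=
  fun x => mdiffAt_inner (mdiffAt_grad hψ x) (mdiffAt_grad hφ x)

theorem continuous_norm_grad {ψ : M → ℝ} (hψ : ContMDiff I 𝓘(ℝ, ℝ) ∞ ψ) :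
    Continuous fun x => ‖grad I ψ x‖ := by
  refine (mdifferentiable_inner_grad hψ hψ).continuous.sqrt.congr fun x => ?_
  rw [real_inner_self_eq_norm_sq, Real.sqrt_sq (norm_nonneg _)]

theorem mvfderiv_inner_grad_self {ψ : M → ℝ} (hψ : ContMDiff I 𝓘(ℝ, ℝ) ∞ ψ) (x : M)
    (v : TangentSpace I x) :
    mvfderiv I (fun p => (inner ℝ (grad I ψ p) (grad I ψ p) : ℝ)) x v =
      2 * hessian I ψ x v (grad I ψ x) := by
  have h := leviCivita_metric (FiberBundle.mdifferentiableAt_extend (I := I) (F := E) v)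
    (mdiffAt_grad hψ x) (mdiffAt_grad hψ x)
  rw [FiberBundle.extend_apply_self] at h
  rw [h, hessian, real_inner_comm, two_mul]

/-- On a compact connected manifold, a solution of the Hessian equation is constant: the squared
norm of its gradient satisfies a linear differential inequality, and it vanishes at a maximum
point. -/
theorem SatisfiesSystem.apply_eq_apply [I.Boundaryless] [CompactSpace M] [PreconnectedSpace M]
    {f ψ : M → ℝ} {ν : ℝ} (h : SatisfiesSystem I f ν ψ) (x y : M) : ψ x = ψ y := by
  have : IsManifold I 1 M := .of_le (n := ∞) (by norm_cast)
  have : IsContinuousRiemannianBundle E (fun x : M => TangentSpace I x) := by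
    obtain ⟨g, hg, hgi⟩ := IsContMDiffRiemannianBundle.exists_contMDiff
      (IB := I) (n := ∞) (F := E) (E := fun x : M => TangentSpace I x)
    exact ⟨g, hg.continuous, hgi⟩
  have hψd : MDifferentiable I 𝓘(ℝ, ℝ) ψ := h.smooth_ψ.mdifferentiable (by simp)
  have : Nonempty M := ⟨x⟩
  obtain ⟨z, -, hz⟩ := isCompact_univ.exists_isMaxOn Set.univ_nonempty
    h.smooth_ψ.continuous.continuousOn
  -- The factor 4 is 2 from differentiating the square times 2 from the two terms of `tensorB`.
  have hcont : Continuous fun p => 4 * (‖grad I f p‖ / f p) :=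
    continuous_const.mul
      ((continuous_norm_grad h.smooth_f).div h.smooth_f.continuous fun p => (h.pos_f p).ne')
  obtain ⟨p₀, -, hp₀⟩ := isCompact_univ.exists_isMaxOn Set.univ_nonempty hcont.continuousOn
  have hgrad : ∀ p, (inner ℝ (grad I ψ p) (grad I ψ p) : ℝ) = 0 := by
    refine eq_zero_of_abs_mvfderiv_le (x₀ := z) (mdifferentiable_inner_grad h.smooth_ψ h.smooth_ψ)
      (K := 4 * (‖grad I f p₀‖ / f p₀)) ?_ (fun p v => ?_) ?_
    · have := h.pos_f p₀
      positivity
    · have hf := h.pos_f p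
      have hle : 4 * (‖grad I f p‖ / f p) ≤ 4 * (‖grad I f p₀‖ / f p₀) := hp₀ (Set.mem_univ p)
      rw [mvfderiv_inner_grad_self h.smooth_ψ, eq_neg_of_add_eq_zero_left (h.hessian_eq p v _),
        real_inner_self_eq_norm_sq, abs_mul, abs_neg, abs_mul,
        abs_of_pos (by positivity : 0 < 1 / f p),
        abs_of_nonneg (sq_nonneg ‖grad I ψ p‖), abs_two]
      calc _ ≤ 2 * (1 / f p * (2 * (‖grad I f p‖ * ‖v‖ * ‖grad I ψ p‖ ^ 2))) := by
            gcongr; exact abs_tensorB_le f ψ p v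
        _ = 4 * (‖grad I f p‖ / f p) * ‖v‖ * ‖grad I ψ p‖ ^ 2 := by ring
        _ ≤ _ := by gcongr
    · rw [inner_grad, mvfderiv_eq_zero_of_isMax (hψd z) fun q => hz (Set.mem_univ q)]
      rfl
  have hdiff : ∀ (p : M) (v : TangentSpace I p), mvfderiv I ψ p v = 0 := fun p v => by
    rw [← inner_grad, inner_self_eq_zero.1 (hgrad p), inner_zero_left]
  -- With `K = 0` the same lemma says that a function with zero differential is constant.
  have := eq_zero_of_abs_mvfderiv_le (I := I) (x₀ := y) (h := fun p => ψ p - ψ y) (K := 0)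
    (fun p => (hψd p).sub mdifferentiableAt_const) le_rfl (fun p v => ?_) (sub_self _) x
  · exact sub_eq_zero.1 this
  · rw [mvfderiv_fun_sub (hψd p) mdifferentiableAt_const, mvfderiv_const]
    simp [hdiff]

/-- The hypothesis `ν * c = 0` covers both the constants with `ν = 0` and the zero function with
arbitrary `ν`. -/
theorem satisfiesSystem_const {f : M → ℝ} (hf : ContMDiff I 𝓘(ℝ, ℝ) ∞ f) (hf_pos : ∀ x, 0 < f x)
    {ν c : ℝ} (hνc : ν * c = 0) : SatisfiesSystem I f ν fun _ => c where
  smooth_f := hf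
  pos_f := hf_pos
  smooth_ψ := contMDiff_const
  hessian_eq x v w := by simp [hessian_const, tensorB, grad_const]
  gradient_eq x := by simp [grad_const, hνc]

end Hessian
end RiemannianHessian

theorem mainTheorem6
    {E : Type*} [NormedAddCommGroup E] [NormedSpace ℝ E] [FiniteDimensional ℝ E]
    {F : Type*} [TopologicalSpace F] [T2Space F] [CompactSpace F] [ConnectedSpace F]
    [ChartedSpace E F] [IsManifold 𝓘(ℝ, E) ∞ F]
    [RiemannianBundle (fun x : F => TangentSpace 𝓘(ℝ, E) x)]
    [IsContMDiffRiemannianBundle 𝓘(ℝ, E) ∞ E (fun x : F => TangentSpace 𝓘(ℝ, E) x)]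
    (f : F → ℝ) (hf : ContMDiff 𝓘(ℝ, E) 𝓘(ℝ, ℝ) ∞ f) (hf_pos : ∀ x, 0 < f x) :
    (∀ (ν : ℝ) (ψ : F → ℝ), ψ ≠ 0 →
      (RiemannianHessian.SatisfiesSystem 𝓘(ℝ, E) f ν ψ ↔ ν = 0 ∧ ∃ c : ℝ, ∀ x, ψ x = c)) ∧
    (∀ ν : ℝ, RiemannianHessian.SatisfiesSystem 𝓘(ℝ, E) f ν (0 : F → ℝ)) := by
  refine ⟨fun ν ψ hψ => ⟨fun h => ?_, ?_⟩, fun ν =>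
    RiemannianHessian.satisfiesSystem_const hf hf_pos (mul_zero ν)⟩
  · obtain ⟨x, hx⟩ := Function.ne_iff.1 hψ
    have hconst : ψ = fun _ => ψ x := funext fun y => h.apply_eq_apply y x
    have hg := h.gradient_eq x
    -- Constancy kills the left side of the gradient equation, leaving `ν * ψ x = 0` at a point
    -- where `ψ x ≠ 0`.
    rw [hconst, RiemannianHessian.grad_const] at hg
    refine ⟨?_, ψ x, fun y => h.apply_eq_apply y x⟩
    simpa [show ψ x ≠ 0 from hx] using hg.symm
  · rintro ⟨rfl, c, hc⟩
    obtain rfl : ψ = fun _ => c := funext hc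
    exact RiemannianHessian.satisfiesSystem_const hf hf_pos (zero_mul c)
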